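/- Let $u_0:\mathbb{R}^2\to\mathbb{R}$ be a bounded smooth function such that the metric $g_0=e^{2u_0}(dx^2+dy^2)$ has bounded scalar curvature. Then there is a constant $C>0$, depending only on $g_0$, such that the following holds. Let $g(t)$, $t\in[0,\infty)$, be the solution of the Ricci flow $$\partial_t g(t)=-R_{g(t)}\,g(t)\quad\text{on }\mathbb{R}^2\times[0,\infty),\qquad g(0)=g_0,$$ that is, a family of Riemannian metrics, smooth on $\mathbb{R}^2\times[0,\infty)$, which satisfies this equation and is uniformly complete on compact time intervals, in the sense that for every $T>0$ there is $c>0$ with $g(t)\ge c\,g(0)$ for all $t\in[0,T]$ (this is so, for example, if the scalar curvature is bounded on $\mathbb{R}^2\times[0,T]$ for every $T$). Then the scalar curvature $R(x,t)=R_{g(t)}(x)$ satisfies $$-\frac{C}{1+Ct}\;\le\;R(x,t)\;\le\;C\qquad\text{for all }(x,t)\in\mathbb{R}^2\times[0,\infty).$$ -/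

import Mathlib

open scoped ContDiff

noncomputable section

namespace PlaneRicciFlow

/-- The plane `ℝ²`, with its global Cartesian coordinates. -/
abbrev Plane : Type := EuclideanSpace ℝ (Fin 2)

/-- A field of `2 × 2` matrices on `ℝ²`: the coordinate components `g_{ij}(x)` of a covariant
2-tensor. -/
abbrev TensorField : Type := Plane → Matrix (Fin 2) (Fin 2) ℝ

/-- The `i`-th coordinate partial derivative. -/
def pderiv (i : Fin 2) (f : Plane → ℝ) (x : Plane) : ℝ :=
  fderiv ℝ f x (EuclideanSpace.single i 1)

/-- `g` is a smooth Riemannian metric on `ℝ²`. -/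
structure IsRiemannianMetric (g : TensorField) : Prop where
  smooth : ∀ i j, ContDiff ℝ ∞ (fun x => g x i j)
  posDef : ∀ x, (g x).PosDef

/-- The Christoffel symbols
`Γ^k_{ij} = ½ ∑_l g^{kl} (∂_i g_{jl} + ∂_j g_{il} - ∂_l g_{ij})`. -/
def christoffel (g : TensorField) (k i j : Fin 2) (x : Plane) : ℝ :=
  (1 / 2) * ∑ l, (g x)⁻¹ k l *
    (pderiv i (fun y => g y j l) x + pderiv j (fun y => g y i l) x
      - pderiv l (fun y => g y i j) x)

/-- The Ricci tensor
`Ric_{jk} = ∑_i (∂_i Γ^i_{jk} - ∂_k Γ^i_{ij}) + ∑_{i,p} (Γ^i_{ip} Γ^p_{jk} - Γ^i_{kp} Γ^p_{ij})`. -/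
def ricci (g : TensorField) (j k : Fin 2) (x : Plane) : ℝ :=
  ∑ i, (pderiv i (christoffel g i j k) x - pderiv k (christoffel g i i j) x)
    + ∑ i, ∑ p, (christoffel g i i p x * christoffel g p j k x
      - christoffel g i k p x * christoffel g p i j x)

/-- The scalar curvature `R_g = ∑_{j,k} g^{jk} Ric_{jk}` (twice the Gauss curvature). -/
def scalarCurvature (g : TensorField) (x : Plane) : ℝ :=
  ∑ j, ∑ k, (g x)⁻¹ j k * ricci g j k x

/-- The conformally flat metric `e^{2u} g_E = e^{2u} (dx² + dy²)`. -/
def conformalMetric (u : Plane → ℝ) : TensorField :=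
  fun x => Real.exp (2 * u x) • (1 : Matrix (Fin 2) (Fin 2) ℝ)

/-- `g` is a smooth solution of the two-dimensional Ricci flow `∂_t g = -R_{g(t)} g` on
`ℝ² × [0, ∞)` (smooth up to and including `t = 0`, with the one-sided time derivative there). -/
structure IsRicciFlow (g : ℝ → TensorField) : Prop where
  smooth : ∀ i j, ContDiffOn ℝ ∞ (fun p : ℝ × Plane => g p.1 p.2 i j)
    (Set.Ici (0 : ℝ) ×ˢ (Set.univ : Set Plane))
  metric : ∀ t, 0 ≤ t → IsRiemannianMetric (g t)
  flow : ∀ t, 0 ≤ t → ∀ x i j,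
    HasDerivWithinAt (fun s => g s x i j) (-scalarCurvature (g t) x * g t x i j) (Set.Ici 0) t

/-- Uniform completeness on compact time intervals, relative to the (complete) initial metric:
for every `T` there is `c > 0` such that `c g(0) ≤ g(t)` as quadratic forms for all
`t ∈ [0, T]`. It holds whenever the curvature is bounded on each `ℝ² × [0, T]`, and
it selects the Ricci flow among the smooth solutions with the same initial metric, which are
otherwise not unique (there are also solutions that become incomplete at once). -/
def LocallyUniformlyComplete (g : ℝ → TensorField) : Prop :=
  ∀ T : ℝ, ∃ c : ℝ, 0 < c ∧ ∀ t ∈ Set.Icc (0 : ℝ) T, ∀ x : Plane, ∀ w : Fin 2 → ℝ,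
    c * (w ⬝ᵥ (g 0 x).mulVec w) ≤ w ⬝ᵥ (g t x).mulVec w

end PlaneRicciFlow

end

/-! The flow multiplies each entry of `g` by the same factor, so the metric stays conformal: `g(t) =
e^{2u}(dx² + dy²)`, with `∂_t u = e^{-2u} Δu` and `R = -2 ∂_t u`. Write `L = ∂_t - e^{-2u} Δ`, with
`Δ` the Euclidean Laplacian. Then `L u = 0` and `L R = R²`.

Every bound comes from one maximum principle, `nonpos_of_heat_le_neg_sq`: if `Z ≤ 0` at time zero
and `L Z ≤ -δ Z²` wherever `Z > 0`, then `Z ≤ 0`. The quadratic damping replaces any growth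
condition at infinity; only an upper bound for `e^{-2u}` is needed, and completeness gives one.
Neither that bound nor `δ` enters the conclusion, so `C` depends on the initial data alone.

Lower bound: `w = -R` satisfies `L w = -w²` and is compared with the ODE solution `C / (1 + C t)`.

Upper bound: the term `R²` now has the wrong sign. The lower bound for `R` first bounds `u` above,
so `u` is bounded, and the maximum principle then gives `|u| ≤ K = sup |u₀|`. For `A` large compared
with `K²`, the quantity `Q = R + (A + u²)|∇u|²_g` satisfies `L Q ≤ -δ Q²`: the good Hessian term in
the evolution of `|∇u|²` absorbs `R²`, and the convexity of `u²` produces `-|∇u|⁴`. So `R ≤ Q ≤ M`,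
where `M` bounds `Q` at time zero. That bound needs `∇u₀` bounded, which follows from bounds on `u₀`
and `Δu₀` by Brandt's gradient estimate. -/

noncomputable section

namespace PlaneRicciFlow

/-! ### Calculus on the space-time half-space, up to the initial time -/

/-- The closed half-space `[0, ∞) × ℝ²` of space-time. -/
def halfSpace : Set (ℝ × Plane) := Set.Ici (0 : ℝ) ×ˢ (Set.univ : Set Plane)

/-- The derivative of `F` on the half-space in the direction `v`. -/
def dd (v : ℝ × Plane) (F : ℝ × Plane → ℝ) (p : ℝ × Plane) : ℝ :=
  fderivWithin ℝ F halfSpace p v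

/-- The direction of time. -/
def et : ℝ × Plane := (1, 0)

/-- The coordinate directions of space. -/
def ex (i : Fin 2) : ℝ × Plane := (0, EuclideanSpace.single i 1)

/-- Smoothness on the half-space, up to the boundary. -/
abbrev Smooth (F : ℝ × Plane → ℝ) : Prop := ContDiffOn ℝ ∞ F halfSpace

theorem mem_halfSpace {p : ℝ × Plane} : p ∈ halfSpace ↔ 0 ≤ p.1 := by
  simp [halfSpace]

theorem uniqueDiffOn_halfSpace : UniqueDiffOn ℝ halfSpace :=
  (uniqueDiffOn_Ici 0).prod uniqueDiffOn_univ

namespace Smooth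

variable {F G : ℝ × Plane → ℝ}

theorem differentiableWithinAt (hF : Smooth F) {p : ℝ × Plane} (hp : p ∈ halfSpace) :
    DifferentiableWithinAt ℝ F halfSpace p :=
  (hF p hp).differentiableWithinAt (by simp)

theorem dd (hF : Smooth F) (v : ℝ × Plane) : Smooth (dd v F) :=
  (ContDiffOn.fderivWithin (m := ∞) hF uniqueDiffOn_halfSpace (by simp)).clm_apply
    contDiffOn_const

end Smooth

section Calculus

variable {F G : ℝ × Plane → ℝ} {p : ℝ × Plane}

theorem dd_congr (v : ℝ × Plane) (h : Set.EqOn F G halfSpace) (hp : p ∈ halfSpace) :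
    dd v F p = dd v G p := by
  rw [dd, dd, fderivWithin_congr h (h hp)]

theorem dd_mul (hF : Smooth F) (hG : Smooth G) (v : ℝ × Plane) (hp : p ∈ halfSpace) :
    dd v (fun q => F q * G q) p = F p * dd v G p + dd v F p * G p := by
  have := fderivWithin_fun_mul (uniqueDiffOn_halfSpace p hp) (hF.differentiableWithinAt hp)
    (hG.differentiableWithinAt hp)
  rw [dd, this]
  simp [dd, mul_comm]

theorem dd_add (hF : Smooth F) (hG : Smooth G) (v : ℝ × Plane) (hp : p ∈ halfSpace) :
    dd v (fun q => F q + G q) p = dd v F p + dd v G p := by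
  have := fderivWithin_fun_add (uniqueDiffOn_halfSpace p hp) (hF.differentiableWithinAt hp)
    (hG.differentiableWithinAt hp)
  rw [dd, this]
  simp [dd]

theorem dd_sub_const (c : ℝ) (v : ℝ × Plane) :
    dd v (fun q => F q - c) p = dd v F p := by
  rw [dd, fderivWithin_sub_const, dd]

theorem dd_const_mul (hF : Smooth F) (c : ℝ) (v : ℝ × Plane) (hp : p ∈ halfSpace) :
    dd v (fun q => c * F q) p = c * dd v F p := by
  have := fderivWithin_const_mul (uniqueDiffOn_halfSpace p hp) (hF.differentiableWithinAt hp) c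
  rw [dd, this]
  simp [dd]

theorem dd_comp (hF : Smooth F) {ψ : ℝ → ℝ} {ψ' : ℝ} (hψ : HasDerivAt ψ ψ' (F p))
    (v : ℝ × Plane) (hp : p ∈ halfSpace) :
    dd v (fun q => ψ (F q)) p = ψ' * dd v F p := by
  have := hψ.comp_hasFDerivWithinAt p (hF.differentiableWithinAt hp).hasFDerivWithinAt
  rw [dd, show (fun q => ψ (F q)) = ψ ∘ F from rfl,
    this.fderivWithin (uniqueDiffOn_halfSpace p hp)]
  simp [dd]

theorem dd_comp_fst {ψ : ℝ → ℝ} {ψ' : ℝ} (hψ : HasDerivAt ψ ψ' p.1)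
    (v : ℝ × Plane) (hp : p ∈ halfSpace) :
    dd v (fun q => ψ q.1) p = ψ' * v.1 := by
  have := hψ.comp_hasFDerivWithinAt p (hasFDerivWithinAt_fst (𝕜 := ℝ) (s := halfSpace))
  rw [dd, show (fun q : ℝ × Plane => ψ q.1) = ψ ∘ Prod.fst from rfl,
    this.fderivWithin (uniqueDiffOn_halfSpace p hp)]
  simp

theorem dd_comm (hF : Smooth F) (v w : ℝ × Plane) (hp : p ∈ halfSpace) :
    dd v (dd w F) p = dd w (dd v F) p := by
  have key : ∀ v w, dd v (dd w F) p = fderivWithin ℝ (fderivWithin ℝ F halfSpace) halfSpace p v w := by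
    intro v w
    have h : DifferentiableWithinAt ℝ (fderivWithin ℝ F halfSpace) halfSpace p :=
      (ContDiffOn.fderivWithin (m := ∞) hF uniqueDiffOn_halfSpace (by simp) p
        hp).differentiableWithinAt (by simp)
    have h2 := h.hasFDerivWithinAt.clm_apply (hasFDerivWithinAt_const w p halfSpace)
    unfold dd
    rw [h2.fderivWithin (uniqueDiffOn_halfSpace p hp)]
    simp
  -- At `t = 0` the symmetry of second derivatives is inherited from interior points, whose closure
  -- is the half-space.
  have hcl : p ∈ closure (interior halfSpace) := by
    rw [halfSpace, interior_prod_eq, closure_prod_eq]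
    simpa using mem_halfSpace.1 hp
  rw [key, key]
  exact ((hF p hp).isSymmSndFDerivWithinAt (by
    simpa using WithTop.coe_le_coe.2 (le_top : (2 : ℕ∞) ≤ ⊤)) uniqueDiffOn_halfSpace hcl hp) v w

theorem hasDerivWithinAt_time (hF : Smooth F) {t : ℝ} (ht : 0 ≤ t) (x : Plane) :
    HasDerivWithinAt (fun s => F (s, x)) (dd et F (t, x)) (Set.Ici 0) t := by
  have h := (hF.differentiableWithinAt (p := (t, x)) (mem_halfSpace.2 ht)).hasFDerivWithinAt
  have h2 : HasDerivWithinAt (fun s : ℝ => (s, x)) et (Set.Ici 0) t :=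
    (hasDerivWithinAt_id t _).prodMk (hasDerivWithinAt_const t _ x)
  exact h.comp_hasDerivWithinAt t h2 (fun s hs => mem_halfSpace.2 hs)

theorem hasFDerivAt_slice (hF : Smooth F) {t : ℝ} (ht : 0 ≤ t) (x : Plane) :
    HasFDerivAt (fun y => F (t, y))
      ((fderivWithin ℝ F halfSpace (t, x)).comp (ContinuousLinearMap.inr ℝ ℝ Plane)) x := by
  have h := (hF.differentiableWithinAt (p := (t, x)) (mem_halfSpace.2 ht)).hasFDerivWithinAt
  have h2 : HasFDerivWithinAt (fun y : Plane => (t, y)) (ContinuousLinearMap.inr ℝ ℝ Plane)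
      Set.univ x := (hasFDerivAt_prodMk_right t x).hasFDerivWithinAt
  exact hasFDerivWithinAt_univ.1 (h.comp x h2 (fun y _ => mem_halfSpace.2 ht))

end Calculus

theorem pderiv_slice {F : ℝ × Plane → ℝ} (hF : Smooth F) {t : ℝ} (ht : 0 ≤ t) (i : Fin 2) (x : Plane) :
    pderiv i (fun y => F (t, y)) x = dd (ex i) F (t, x) := by
  rw [pderiv, (hasFDerivAt_slice hF ht x).fderiv]
  simp [dd, ex]

theorem hasDerivAt_line {f : Plane → ℝ} (x : Plane) (i : Fin 2) (h : ℝ)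
    (hf : DifferentiableAt ℝ f (x + h • EuclideanSpace.single i 1)) :
    HasDerivAt (fun s : ℝ => f (x + s • EuclideanSpace.single i 1))
      (pderiv i f (x + h • EuclideanSpace.single i 1)) h := by
  have h2 : HasDerivAt (fun s : ℝ => x + s • (EuclideanSpace.single i 1 : Plane))
      (EuclideanSpace.single i 1) h := by
    simpa using ((hasDerivAt_id h).smul_const (EuclideanSpace.single i (1 : ℝ))).const_add x
  exact hf.hasFDerivAt.comp_hasDerivAt h h2

theorem contDiff_slice {F : ℝ × Plane → ℝ} (hF : Smooth F) {t : ℝ} (ht : 0 ≤ t) :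
    ContDiff ℝ ∞ (fun y => F (t, y)) := by
  rw [← contDiffOn_univ]
  exact hF.comp (contDiff_prodMk_right t).contDiffOn (fun y _ => mem_halfSpace.2 ht)

theorem contDiff_pderiv {f : Plane → ℝ} (hf : ContDiff ℝ ∞ f) (i : Fin 2) :
    ContDiff ℝ ∞ (pderiv i f) :=
  (hf.fderiv_right (m := ∞) (by simp)).clm_apply contDiff_const

/-! ### The maximum principle without growth conditions -/

/-- The heat operator `∂_t - a (∂_x² + ∂_y²)`. -/
def heat (a F : ℝ × Plane → ℝ) (p : ℝ × Plane) : ℝ :=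
  dd et F p - a p * (dd (ex 0) (dd (ex 0) F) p + dd (ex 1) (dd (ex 1) F) p)

/-- If `c > 0`, the second derivative test makes the point a local minimum as well, so `φ` is
locally constant there and `c = 0`. -/
theorem second_deriv_nonpos_of_isLocalMax {φ φ' : ℝ → ℝ} {c x : ℝ}
    (h : ∀ᶠ y in nhds x, HasDerivAt φ (φ' y) y) (h' : HasDerivAt φ' c x)
    (hmax : IsLocalMax φ x) : c ≤ 0 := by
  by_contra! hc
  have e : deriv φ =ᶠ[nhds x] φ' := h.mono fun y hy => hy.deriv
  have hd : deriv (deriv φ) x = c := by rw [e.deriv_eq, h'.deriv]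
  have hmin : IsLocalMin φ x :=
    isLocalMin_of_deriv_deriv_pos (hd ▸ hc) hmax.deriv_eq_zero h.self_of_nhds.continuousAt
  have hconst : φ =ᶠ[nhds x] fun _ => φ x := by
    filter_upwards [hmax, hmin] with y h1 h2 using le_antisymm h1 h2
  have : deriv φ =ᶠ[nhds x] fun _ => 0 := by
    filter_upwards [hconst.deriv] with y hy
    simpa using hy
  rw [this.deriv_eq] at hd
  simp at hd
  linarith

/-- First and second order conditions at a local maximum of `f`, along a coordinate line. -/
theorem pderiv_conditions_of_isLocalMax {f : Plane → ℝ} (hf : ContDiff ℝ ∞ f) {x : Plane}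
    (hmax : IsLocalMax f x) (i : Fin 2) :
    pderiv i f x = 0 ∧ pderiv i (pderiv i f) x ≤ 0 := by
  have hl : ∀ {g : Plane → ℝ}, ContDiff ℝ ∞ g → ∀ h : ℝ,
      HasDerivAt (fun s : ℝ => g (x + s • EuclideanSpace.single i 1))
      (pderiv i g (x + h • EuclideanSpace.single i 1)) h := fun hg h =>
    hasDerivAt_line x i h (hg.differentiable (by simp) _)
  constructor
  · rw [pderiv, hmax.fderiv_eq_zero]; simp
  · have hm : IsLocalMax (fun s : ℝ => f (x + s • EuclideanSpace.single i 1)) 0 := by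
      have hc : ContinuousAt (fun s : ℝ => x + s • (EuclideanSpace.single i 1 : Plane)) 0 := by
        fun_prop
      have hx : x + (0 : ℝ) • (EuclideanSpace.single i 1 : Plane) = x := by simp
      have := (show IsLocalMax f (x + (0 : ℝ) • (EuclideanSpace.single i 1 : Plane)) by rwa [hx])
      exact IsLocalMax.comp_continuous
        (g := fun s : ℝ => x + s • (EuclideanSpace.single i 1 : Plane)) this hc
    have h2 := hl (contDiff_pderiv hf i) 0
    have := second_deriv_nonpos_of_isLocalMax (Filter.Eventually.of_forall (hl hf)) h2 hm
    simpa using this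

theorem pderiv_mul {f g : Plane → ℝ} (hf : ContDiff ℝ ∞ f) (hg : ContDiff ℝ ∞ g) (i : Fin 2) :
    pderiv i (fun y => f y * g y) = fun x => f x * pderiv i g x + pderiv i f x * g x := by
  funext x
  rw [pderiv, fderiv_fun_mul (hf.differentiable (by simp) x) (hg.differentiable (by simp) x)]
  simp [pderiv, mul_comm]

theorem pderiv_add {f g : Plane → ℝ} (hf : ContDiff ℝ ∞ f) (hg : ContDiff ℝ ∞ g) (i : Fin 2) :
    pderiv i (fun y => f y + g y) = fun x => pderiv i f x + pderiv i g x := by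
  funext x
  rw [pderiv, fderiv_fun_add (hf.differentiable (by simp) x) (hg.differentiable (by simp) x)]
  simp [pderiv]

theorem pderiv_comp {f : Plane → ℝ} (hf : ContDiff ℝ ∞ f) {ψ ψ' : ℝ → ℝ}
    (hψ : ∀ s, HasDerivAt ψ (ψ' s) s) (i : Fin 2) :
    pderiv i (fun y => ψ (f y)) = fun x => ψ' (f x) * pderiv i f x := by
  funext x
  have := (hψ (f x)).comp_hasFDerivAt x (hf.differentiable (by simp) x).hasFDerivAt
  rw [pderiv, show (fun y => ψ (f y)) = ψ ∘ f from rfl, this.fderiv]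
  simp [pderiv]

theorem pderiv_const (c : ℝ) (i : Fin 2) : pderiv i (fun _ => c) = fun _ => 0 := by
  funext x; simp [pderiv]

theorem contDiff_coord (i : Fin 2) : ContDiff ℝ ∞ (fun y : Plane => y i) :=
  contDiff_piLp_apply 2

theorem pderiv_coord (i j : Fin 2) :
    pderiv i (fun y => y j) = fun _ => if j = i then 1 else 0 := by
  funext x
  have : HasFDerivAt (fun y : Plane => y j) (EuclideanSpace.proj j : Plane →L[ℝ] ℝ) x :=
    (EuclideanSpace.proj j : Plane →L[ℝ] ℝ).hasFDerivAt
  rw [pderiv, this.fderiv]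
  simp

theorem pderiv_sqDist (r : ℝ) (i : Fin 2) :
    pderiv i (fun y => r ^ 2 - ‖y‖ ^ 2) = fun x => -2 * x i := by
  funext x
  have : HasFDerivAt (fun y : Plane => r ^ 2 - ‖y‖ ^ 2) (-(2 • innerSL ℝ x)) x :=
    ((hasStrictFDerivAt_norm_sq x).hasFDerivAt).const_sub _
  rw [pderiv, this.fderiv]
  simp [EuclideanSpace.inner_single_right]

theorem contDiff_sqDist (r : ℝ) : ContDiff ℝ ∞ (fun y : Plane => r ^ 2 - ‖y‖ ^ 2) :=
  contDiff_const.sub (contDiff_norm_sq ℝ)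

/-- At an interior maximum of `f (r² - |x|²)²`, the second derivatives of `f` are bounded. -/
theorem laplacian_le_of_isLocalMax_weighted {f : Plane → ℝ} (hf : ContDiff ℝ ∞ f) {r : ℝ}
    {x : Plane} (hx : ‖x‖ < r) (hfx : 0 ≤ f x)
    (hmax : IsLocalMax (fun y => f y * (r ^ 2 - ‖y‖ ^ 2) ^ 2) x) :
    (pderiv 0 (pderiv 0 f) x + pderiv 1 (pderiv 1 f) x) * (r ^ 2 - ‖x‖ ^ 2) ^ 2
      ≤ 24 * r ^ 2 * f x := by
  have hs := contDiff_sqDist r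
  have hs0 : 0 < r ^ 2 - ‖x‖ ^ 2 := by nlinarith [norm_nonneg x]
  have hn : ‖x‖ ^ 2 = x 0 ^ 2 + x 1 ^ 2 := by
    rw [EuclideanSpace.norm_sq_eq]; simp
  have key : ∀ i, pderiv i (pderiv i f) x * (r ^ 2 - ‖x‖ ^ 2) ^ 2 ≤
      f x * (24 * x i ^ 2 + 4 * (r ^ 2 - ‖x‖ ^ 2)) := by
    intro i
    obtain ⟨h1, h2⟩ := pderiv_conditions_of_isLocalMax (hf.mul (hs.pow 2)) hmax i
    have hd := contDiff_pderiv hf i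
    have hlin : ContDiff ℝ ∞ (fun y : Plane => -2 * y i) := contDiff_const.mul (contDiff_coord i)
    have e1 : pderiv i (fun y => f y * (r ^ 2 - ‖y‖ ^ 2) ^ 2) = fun y =>
        (r ^ 2 - ‖y‖ ^ 2) * (f y * (2 * (-2 * y i)) + pderiv i f y * (r ^ 2 - ‖y‖ ^ 2)) := by
      rw [pderiv_mul hf (hs.pow 2),
        pderiv_comp hs (ψ := fun s => s ^ 2) (ψ' := fun s => 2 * s) (fun s => by
          simpa using hasDerivAt_pow 2 s), pderiv_sqDist]
      funext y; ring
    have e2 : pderiv i (fun y : Plane => 2 * (-2 * y i)) = fun _ => -4 := by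
      rw [pderiv_mul contDiff_const hlin, pderiv_mul contDiff_const (contDiff_coord i),
        pderiv_coord, pderiv_const, pderiv_const]
      funext y; simp; norm_num
    rw [e1] at h1 h2
    rw [pderiv_mul hs ((hf.mul (contDiff_const.mul hlin)).add (hd.mul hs)),
      pderiv_add (hf.mul (contDiff_const.mul hlin)) (hd.mul hs),
      pderiv_mul hf (contDiff_const.mul hlin), pderiv_mul hd hs, pderiv_sqDist, e2] at h2
    simp only at h1 h2
    set s := r ^ 2 - ‖x‖ ^ 2
    set f' := pderiv i f x
    have h3 : f x * (2 * (-2 * x i)) + f' * s = 0 := (mul_eq_zero.1 h1).resolve_left hs0.ne'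
    have h4 : f' * s = 4 * f x * x i := by linarith
    -- With `s = r² - |x|²`, the second-order condition is `f'' s² - 8 xᵢ f' s + f (8 xᵢ² - 4 s) ≤
    -- 0`; the first-order condition `f' s = 4 f xᵢ` eliminates `f'`.
    linear_combination h2 + (6 * x i) * h4 + 2 * x i * h3
  have := key 0
  have := key 1
  nlinarith [mul_nonneg hfx (sq_nonneg r)]

theorem dd_time_nonneg {Z : ℝ × Plane → ℝ} (hZ : Smooth Z) {t : ℝ} (ht : 0 < t) {x : Plane}
    (h : ∀ s ∈ Set.Icc 0 t, Z (s, x) ≤ Z (t, x)) : 0 ≤ dd et Z (t, x) := by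
  have hd : HasDerivWithinAt (fun s => Z (s, x)) (dd et Z (t, x)) (Set.Icc 0 t) t :=
    (hasDerivWithinAt_time hZ ht.le x).mono fun _ hs => hs.1
  have hmax : IsLocalMaxOn (fun s => Z (s, x)) (Set.Icc 0 t) t :=
    Filter.eventually_of_mem self_mem_nhdsWithin h
  have hcone : (0 : ℝ) - t ∈ posTangentConeAt (Set.Icc 0 t) t :=
    sub_mem_posTangentConeAt_of_segment_subset
      ((convex_Icc 0 t).segment_subset ⟨ht.le, le_rfl⟩ ⟨le_rfl, ht.le⟩)
  have := hmax.hasFDerivWithinAt_nonpos hd.hasFDerivWithinAt hcone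
  simp at this
  exact nonneg_of_mul_nonneg_right this ht

/-- Maximum principle on the plane, for functions without any growth condition. -/
theorem nonpos_of_heat_le_neg_sq {Z a : ℝ × Plane → ℝ} (hZ : Smooth Z) {T Λ δ : ℝ}
    (hδ : 0 < δ)
    (ha : ∀ t ∈ Set.Icc 0 T, ∀ x, 0 ≤ a (t, x) ∧ a (t, x) ≤ Λ)
    (h0 : ∀ x, Z (0, x) ≤ 0)
    (hL : ∀ t ∈ Set.Icc 0 T, ∀ x, 0 < Z (t, x) → heat a Z (t, x) ≤ -δ * Z (t, x) ^ 2) :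
    ∀ t ∈ Set.Icc 0 T, ∀ x, Z (t, x) ≤ 0 := by
  -- Localization in the style of Keller and Osserman: at a positive maximum of `Z (r² - |x|²)²` on
  -- the cylinder, the damping gives `δ Z² ≤ a ΔZ`, while the cutoff bounds `ΔZ`. The right side
  -- grows like `r²` and the cutoff like `r⁴`, so `r → ∞` forces `Z ≤ 0`.
  have main : ∀ r : ℝ, 0 < r → ∀ t ∈ Set.Icc 0 T, ∀ x : Plane, ‖x‖ ≤ r →
      Z (t, x) * (r ^ 2 - ‖x‖ ^ 2) ^ 2 ≤ 24 * Λ * r ^ 2 / δ := by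
    intro r hr t ht x hx
    have hΛ : 0 ≤ Λ := (ha t ht x).1.trans (ha t ht x).2
    let W : ℝ × Plane → ℝ := fun p => Z p * (r ^ 2 - ‖p.2‖ ^ 2) ^ 2
    have hcomp : IsCompact (Set.Icc 0 T ×ˢ Metric.closedBall (0 : Plane) r) :=
      isCompact_Icc.prod (isCompact_closedBall _ _)
    have hcont : ContinuousOn W (Set.Icc 0 T ×ˢ Metric.closedBall (0 : Plane) r) := by
      refine ContinuousOn.mul (hZ.continuousOn.mono ?_) (by fun_prop)
      intro p hp
      exact mem_halfSpace.2 hp.1.1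
    have hmem : (t, x) ∈ Set.Icc 0 T ×ˢ Metric.closedBall (0 : Plane) r :=
      ⟨ht, by simpa using hx⟩
    obtain ⟨⟨t₀, x₀⟩, ⟨ht₀, hx₀⟩, hmax⟩ := hcomp.exists_isMaxOn ⟨_, hmem⟩ hcont
    refine (hmax hmem).trans ?_
    show W (t₀, x₀) ≤ _
    have hK : 0 ≤ 24 * Λ * r ^ 2 / δ := by positivity
    by_contra! hlt
    have hpos : 0 < W (t₀, x₀) := hK.trans_lt hlt
    simp only [W] at hpos hlt
    have hx₀' : ‖x₀‖ ≤ r := by simpa using hx₀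
    have hZpos : 0 < Z (t₀, x₀) := pos_of_mul_pos_left hpos (sq_nonneg _)
    have hx₁ : ‖x₀‖ < r := by
      refine lt_of_le_of_ne hx₀' fun h => ?_
      rw [h] at hpos; simp at hpos
    have hs0 : 0 < r ^ 2 - ‖x₀‖ ^ 2 := by nlinarith [norm_nonneg x₀]
    have ht₁ : 0 < t₀ := by
      refine lt_of_le_of_ne ht₀.1 fun h => ?_
      have := h0 x₀
      rw [← h] at hZpos
      simp only at *
      linarith
    have hlap := laplacian_le_of_isLocalMax_weighted (contDiff_slice hZ ht₀.1) hx₁ hZpos.le (by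
      filter_upwards [Metric.isOpen_ball.mem_nhds (show x₀ ∈ Metric.ball (0 : Plane) r by
        simpa using hx₁)] with y hy
      exact hmax (show (t₀, y) ∈ _ from ⟨ht₀, Metric.ball_subset_closedBall hy⟩))
    have htime : 0 ≤ dd et Z (t₀, x₀) := by
      refine dd_time_nonneg hZ ht₁ fun s hs => ?_
      have : W (s, x₀) ≤ W (t₀, x₀) :=
        hmax (show (s, x₀) ∈ _ from ⟨⟨hs.1, hs.2.trans ht₀.2⟩, hx₀⟩)
      exact le_of_mul_le_mul_right this (by positivity)
    have hp2 : ∀ i, pderiv i (pderiv i (fun y => Z (t₀, y))) x₀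
        = dd (ex i) (dd (ex i) Z) (t₀, x₀) := by
      intro i
      rw [← pderiv_slice (hZ.dd _) ht₀.1]
      congr 1
      funext y
      exact pderiv_slice hZ ht₀.1 i y
    rw [hp2, hp2] at hlap
    have hh := hL t₀ ht₀ x₀ hZpos
    obtain ⟨ha0, ha1⟩ := ha t₀ ht₀ x₀
    rw [heat] at hh
    set z := Z (t₀, x₀)
    set s := r ^ 2 - ‖x₀‖ ^ 2
    set A := a (t₀, x₀)
    set Δ := dd (ex 0) (dd (ex 0) Z) (t₀, x₀) + dd (ex 1) (dd (ex 1) Z) (t₀, x₀)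
    have h1 : δ * z ^ 2 ≤ A * Δ := by linarith
    have h2 : δ * z ^ 2 * s ^ 2 ≤ Λ * (24 * r ^ 2 * z) :=
      calc δ * z ^ 2 * s ^ 2 ≤ A * Δ * s ^ 2 := by gcongr
        _ = A * (Δ * s ^ 2) := by ring
        _ ≤ A * (24 * r ^ 2 * z) := by gcongr
        _ ≤ Λ * (24 * r ^ 2 * z) := by gcongr
    have h3 : δ * (z * s ^ 2) ≤ 24 * Λ * r ^ 2 := by
      refine le_of_mul_le_mul_right ?_ hZpos
      linarith
    rw [div_lt_iff₀ hδ] at hlt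
    linarith
  intro t ht x
  by_contra! hz
  have hΛ : 0 ≤ Λ := (ha t ht x).1.trans (ha t ht x).2
  set z := Z (t, x)
  set n := ‖x‖ ^ 2
  have hn : 0 ≤ n := by positivity
  set K := 24 * Λ / δ
  have hK : 0 ≤ K := by positivity
  -- `ρ` is the squared radius: `ρ ≥ 2n` keeps the cutoff at least `ρ / 2`, so the local estimate
  -- would give `z ρ ≤ 4 K`, which the term `4 K / z` and the extra `1` exclude.
  set ρ := 2 * n + 4 * K / z + 1
  have hρ : 0 < ρ := by positivity
  have h := main (Real.sqrt ρ) (Real.sqrt_pos.2 hρ) t ht x (by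
    refine Real.le_sqrt_of_sq_le ?_
    have : 0 ≤ 4 * K / z := by positivity
    show n ≤ ρ
    simp only [ρ]; linarith)
  rw [Real.sq_sqrt hρ.le] at h
  change z * (ρ - n) ^ 2 ≤ _ at h
  have e : 24 * Λ * ρ / δ = K * ρ := by simp only [K]; ring
  rw [e] at h
  have h4 : 4 * K < z * ρ := by
    have : z * ρ = z * (2 * n + 1) + 4 * K := by simp only [ρ]; field_simp; ring
    rw [this]
    have : 0 < z * (2 * n + 1) := by positivity
    linarith
  have h5 : ρ / 2 ≤ ρ - n := by
    have : 0 ≤ 4 * K / z := by positivity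
    simp only [ρ]; linarith
  have h6 : z * (ρ / 2) ^ 2 ≤ z * (ρ - n) ^ 2 := by gcongr
  nlinarith

/-! ### Curvature of a conformally flat metric -/

theorem conformalMetric_apply (u : Plane → ℝ) (x : Plane) (i j : Fin 2) :
    conformalMetric u x i j = Real.exp (2 * u x) * if i = j then 1 else 0 := by
  simp [conformalMetric, Matrix.one_apply]

theorem conformalMetric_inv (u : Plane → ℝ) (x : Plane) (i j : Fin 2) :
    (conformalMetric u x)⁻¹ i j = Real.exp (-2 * u x) * if i = j then 1 else 0 := by
  have : (conformalMetric u x)⁻¹ = Real.exp (-2 * u x) • 1 := by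
    apply Matrix.inv_eq_left_inv
    rw [conformalMetric, smul_mul_smul_comm, one_mul, ← Real.exp_add]
    simp
  rw [this]
  simp [Matrix.one_apply]

theorem pderiv_conformalMetric {u : Plane → ℝ} (hu : ContDiff ℝ ∞ u) (i j k : Fin 2) (x : Plane) :
    pderiv i (fun y => conformalMetric u y j k) x =
      2 * Real.exp (2 * u x) * pderiv i u x * if j = k then 1 else 0 := by
  have h := pderiv_comp hu (ψ := fun s => Real.exp (2 * s) * if j = k then 1 else 0)
    (ψ' := fun s => 2 * Real.exp (2 * s) * if j = k then 1 else 0) (fun s => by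
      have := (((hasDerivAt_id' s).const_mul 2).exp).mul_const (if j = k then (1 : ℝ) else 0)
      exact this.congr_deriv (by ring)) i
  simp only [conformalMetric_apply]
  rw [h]
  ring

theorem christoffel_conformalMetric {u : Plane → ℝ} (hu : ContDiff ℝ ∞ u) (k i j : Fin 2) :
    christoffel (conformalMetric u) k i j = fun x =>
      ((if k = j then 1 else 0) * pderiv i u x + (if k = i then 1 else 0) * pderiv j u x)
        + (if i = j then -1 else 0) * pderiv k u x := by
  funext x
  have he : Real.exp (-2 * u x) * Real.exp (2 * u x) = 1 := by
    rw [← Real.exp_add]; simp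
  simp only [christoffel, pderiv_conformalMetric hu, conformalMetric_inv]
  calc _ = (Real.exp (-2 * u x) * Real.exp (2 * u x)) *
      (((if k = j then 1 else 0) * pderiv i u x + (if k = i then 1 else 0) * pderiv j u x)
        + (if i = j then -1 else 0) * pderiv k u x) := by
        fin_cases k <;> fin_cases i <;> fin_cases j <;> simp <;> ring
    _ = _ := by rw [he, one_mul]

/-- The scalar curvature of `e^{2u} (dx² + dy²)` is `-2 e^{-2u} Δu`. -/
theorem scalarCurvature_conformalMetric {u : Plane → ℝ} (hu : ContDiff ℝ ∞ u) (x : Plane) :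
    scalarCurvature (conformalMetric u) x =
      -2 * Real.exp (-2 * u x) * (pderiv 0 (pderiv 0 u) x + pderiv 1 (pderiv 1 u) x) := by
  have hd := fun i => contDiff_pderiv hu i
  have hp : ∀ m i j k (a b c : ℝ), pderiv m (fun x =>
      (a * pderiv i u x + b * pderiv j u x) + c * pderiv k u x) x =
      (a * pderiv m (pderiv i u) x + b * pderiv m (pderiv j u) x)
        + c * pderiv m (pderiv k u) x := by
    intro m i j k a b c
    rw [pderiv_add ((contDiff_const.mul (hd i)).add (contDiff_const.mul (hd j)))
        (contDiff_const.mul (hd k)),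
      pderiv_add (contDiff_const.mul (hd i)) (contDiff_const.mul (hd j)),
      pderiv_mul contDiff_const (hd i), pderiv_mul contDiff_const (hd j),
      pderiv_mul contDiff_const (hd k)]
    simp [pderiv_const]
  simp only [scalarCurvature, ricci, christoffel_conformalMetric hu, hp, conformalMetric_inv,
    Fin.sum_univ_two]
  simp
  ring

/-! ### Gradient estimate for the initial conformal factor -/

/-- The reflection of the plane in the line through `x` orthogonal to the `i`-th axis. -/
def reflect (x : Plane) (i : Fin 2) (y : Plane) : Plane :=
  y - (2 * (y i - x i)) • EuclideanSpace.single i 1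

theorem contDiff_reflect (x : Plane) (i : Fin 2) : ContDiff ℝ ∞ (reflect x i) :=
  contDiff_id.sub ((contDiff_const.mul ((contDiff_coord i).sub contDiff_const)).smul
    contDiff_const)

theorem pderiv_comp_reflect {f : Plane → ℝ} (hf : ContDiff ℝ ∞ f) (x : Plane) (i k : Fin 2) :
    pderiv k (fun y => f (reflect x i y)) =
      fun y => (if k = i then -1 else 1) * pderiv k f (reflect x i y) := by
  funext y
  have hcoord : HasFDerivAt (fun y : Plane => y i) (EuclideanSpace.proj i : Plane →L[ℝ] ℝ) y :=
    (EuclideanSpace.proj i : Plane →L[ℝ] ℝ).hasFDerivAt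
  have h := (hasFDerivAt_id y).sub
    (((hcoord.sub_const (x i)).const_mul 2).smul_const (EuclideanSpace.single i (1 : ℝ) : Plane))
  have hr : HasFDerivAt (reflect x i) _ y := h
  have h2 := (hf.differentiable (by simp) (reflect x i y)).hasFDerivAt.comp y hr
  rw [pderiv, show (fun y => f (reflect x i y)) = f ∘ reflect x i from rfl, h2.fderiv]
  by_cases hk : k = i
  · subst hk
    simp [pderiv]
    ring
  · have : i ≠ k := fun h => hk h.symm
    simp [pderiv, hk, this]

theorem pderiv2_comp_reflect {f : Plane → ℝ} (hf : ContDiff ℝ ∞ f) (x : Plane) (i k : Fin 2)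
    (y : Plane) :
    pderiv k (pderiv k (fun y => f (reflect x i y))) y
      = pderiv k (pderiv k f) (reflect x i y) := by
  have hd := contDiff_pderiv hf k
  have hdr : ContDiff ℝ ∞ (fun y => pderiv k f (reflect x i y)) :=
    hd.comp (contDiff_reflect x i)
  rw [pderiv_comp_reflect hf, pderiv_mul contDiff_const hdr,
    pderiv_const, pderiv_comp_reflect hd]
  split_ifs <;> simp

theorem pderiv_dist_sq (x : Plane) (i : Fin 2) :
    pderiv i (fun y => ‖y - x‖ ^ 2) = fun y => 2 * (y i - x i) := by
  funext y
  have : HasFDerivAt (fun y : Plane => ‖y - x‖ ^ 2) (2 • innerSL ℝ (y - x)) y := by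
    exact ((hasStrictFDerivAt_norm_sq (y - x)).hasFDerivAt).comp y
      ((hasFDerivAt_id y).sub_const x)
  rw [pderiv, this.fderiv]
  simp [EuclideanSpace.inner_single_right]

theorem pderiv_coord_sub (x : Plane) (k i : Fin 2) :
    pderiv k (fun y => y i - x i) = fun _ => if i = k then 1 else 0 := by
  have := pderiv_add (contDiff_coord i) (contDiff_const (c := -x i)) k
  rw [pderiv_coord, pderiv_const] at this
  simpa [sub_eq_add_neg] using this

/-- Interior gradient estimate for the Poisson equation, by Brandt's reflection argument. -/
theorem pderiv_le_of_laplacian_bounded {f : Plane → ℝ} (hf : ContDiff ℝ ∞ f) {K N : ℝ}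
    (hK : ∀ x, |f x| ≤ K)
    (hN : ∀ x, |pderiv 0 (pderiv 0 f) x + pderiv 1 (pderiv 1 f) x| ≤ N) (i : Fin 2) (x : Plane) :
    pderiv i f x ≤ 2 * K + N / 2 + 1 := by
  set L := 2 * K + N / 2 + 1 with hL
  have hK0 : 0 ≤ K := (abs_nonneg _).trans (hK x)
  have hN0 : 0 ≤ N := (abs_nonneg _).trans (hN x)
  have hL0 : 0 ≤ L := by positivity
  let s : Plane → ℝ := fun y => y i - x i
  have hs : ContDiff ℝ ∞ s := (contDiff_coord i).sub contDiff_const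
  let fr : Plane → ℝ := fun y => f (reflect x i y)
  have hfr : ContDiff ℝ ∞ fr := hf.comp (contDiff_reflect x i)
  let D : Plane → ℝ := fun y => ‖y - x‖ ^ 2
  have hD : ContDiff ℝ ∞ D := (contDiff_norm_sq ℝ).comp (contDiff_id.sub contDiff_const)
  have hV0 : ContDiff ℝ ∞ (fun y => 1 / 2 * f y + -1 / 2 * fr y) :=
    (contDiff_const.mul hf).add (contDiff_const.mul hfr)
  have hV1 : ContDiff ℝ ∞ (fun y => -K * D y + (-L * s y + L * s y ^ 2)) :=
    (contDiff_const.mul hD).add ((contDiff_const.mul hs).add (contDiff_const.mul (hs.pow 2)))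
  -- The odd part of `f` under the reflection, plus a barrier. On the half-ball `B`, `V ≤ 0` on the
  -- flat face because the odd part vanishes, and on the spherical part because `-K D = -K` beats
  -- the odd part and `s² ≤ s`. The Laplacian is at least `-N - 4K + 2L = 2`, so there is no
  -- interior maximum. The `+ 1` in `L` makes this strict.
  let V : Plane → ℝ := fun y =>
    (1 / 2 * f y + -1 / 2 * fr y) + (-K * D y + (-L * s y + L * s y ^ 2))
  have hV : ContDiff ℝ ∞ V := hV0.add hV1
  have hmul : ∀ (c : ℝ) {h : Plane → ℝ}, ContDiff ℝ ∞ h → ∀ k,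
      pderiv k (fun y => c * h y) = fun y => c * pderiv k h y := by
    intro c h hh k
    rw [pderiv_mul contDiff_const hh, pderiv_const]; simp
  have e1 : ∀ k, pderiv k V = fun y =>
      (1 / 2 * pderiv k f y + -1 / 2 * pderiv k fr y) +
      (-K * (2 * (y k - x k)) + (-L * (if i = k then 1 else 0)
        + L * ((2 * if i = k then 1 else 0) * s y))) := by
    intro k
    rw [pderiv_add hV0 hV1, pderiv_add (contDiff_const.mul hf) (contDiff_const.mul hfr),
      pderiv_add (contDiff_const.mul hD) ((contDiff_const.mul hs).add
        (contDiff_const.mul (hs.pow 2))),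
      pderiv_add (contDiff_const.mul hs) (contDiff_const.mul (hs.pow 2)),
      hmul _ hf, hmul _ hfr, hmul _ hD, hmul _ hs, hmul _ (hs.pow 2), pderiv_dist_sq,
      pderiv_comp hs (ψ := fun s => s ^ 2) (ψ' := fun s => 2 * s) (fun s => by
          simpa using hasDerivAt_pow 2 s), pderiv_coord_sub]
    funext y
    ring
  have e2 : ∀ k y, pderiv k (pderiv k V) y =
      (1 / 2 * pderiv k (pderiv k f) y + -1 / 2 * pderiv k (pderiv k f) (reflect x i y)) +
      (-2 * K + if i = k then 2 * L else 0) := by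
    intro k y
    have hk : ContDiff ℝ ∞ (fun y : Plane => y k - x k) :=
      (contDiff_coord k).sub contDiff_const
    have a1 := contDiff_pderiv hf k
    have a2 := contDiff_pderiv hfr k
    have a3 : ContDiff ℝ ∞ (fun y : Plane => 2 * (y k - x k)) := contDiff_const.mul hk
    have a4 : ContDiff ℝ ∞ (fun y : Plane => (2 * if i = k then 1 else 0) * s y) :=
      contDiff_const.mul hs
    rw [e1, pderiv_add ((contDiff_const.mul a1).add (contDiff_const.mul a2))
        ((contDiff_const.mul a3).add (contDiff_const.add (contDiff_const.mul a4))),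
      pderiv_add (contDiff_const.mul a1) (contDiff_const.mul a2),
      pderiv_add (contDiff_const.mul a3) (contDiff_const.add (contDiff_const.mul a4)),
      pderiv_add contDiff_const (contDiff_const.mul a4), hmul _ a1, hmul _ a2, hmul _ a3,
      hmul _ a4, hmul _ hk, hmul _ hs, pderiv_coord_sub, pderiv_coord_sub, pderiv_const]
    simp only [fr]
    rw [pderiv2_comp_reflect hf]
    split_ifs <;> simp <;> ring
  have hlap : ∀ y, 2 ≤ pderiv 0 (pderiv 0 V) y + pderiv 1 (pderiv 1 V) y := by
    intro y
    have h1 := (abs_le.1 (hN y)).1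
    have h2 := (abs_le.1 (hN (reflect x i y))).2
    rw [e2, e2]
    have : ((if i = 0 then 2 * L else 0) + if i = 1 then 2 * L else 0) = 2 * L := by
      fin_cases i <;> simp
    linarith
  let B : Set Plane := Metric.closedBall x 1 ∩ {y | 0 ≤ s y}
  have hB : IsCompact B :=
    (isCompact_closedBall x 1).inter_right (isClosed_le continuous_const hs.continuous)
  have hsD : ∀ y, s y ^ 2 ≤ D y := by
    intro y
    have : D y = (y 0 - x 0) ^ 2 + (y 1 - x 1) ^ 2 := by
      simp [D, EuclideanSpace.norm_sq_eq]
    rw [this]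
    fin_cases i
    · simpa [s] using sq_nonneg _
    · simpa [s] using sq_nonneg _
  have hx0 : s x = 0 := sub_self _
  have hrefl : ∀ y, s y = 0 → fr y = f y := by
    intro y hy
    change y i - x i = 0 at hy
    simp [fr, reflect, hy]
  have hVB : ∀ y ∈ B, V y ≤ 0 := by
    obtain ⟨p, ⟨hp1, hp2⟩, hmax⟩ := hB.exists_isMaxOn
      ⟨x, by simp, hx0.ge⟩ hV.continuous.continuousOn
    suffices V p ≤ 0 from fun y hy => (hmax hy).trans this
    have hp1' : ‖p - x‖ ≤ 1 := by simpa [dist_eq_norm] using hp1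
    have hp2' : 0 ≤ s p := hp2
    have hDp : 0 ≤ D p := sq_nonneg _
    rcases eq_or_lt_of_le hp2' with h | h
    · have := hrefl p h.symm
      simp only [V, this, ← h]
      nlinarith
    rcases eq_or_lt_of_le hp1' with h1 | h1
    · have hD1 : D p = 1 := by simp [D, h1]
      have hsp := hsD p
      have hs1 : s p ≤ 1 := by nlinarith
      have := (abs_le.1 (hK p)).2
      have := (abs_le.1 (hK (reflect x i p))).1
      have : L * s p ^ 2 ≤ L * s p := by nlinarith [mul_nonneg hL0 hp2']
      simp only [V, hD1, fr]
      linarith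
    · have hloc : IsLocalMax V p := by
        have h3 : ∀ᶠ y in nhds p, y ∈ Metric.ball x 1 :=
          Metric.isOpen_ball.mem_nhds (by simpa [dist_eq_norm] using h1)
        have h4 : ∀ᶠ y in nhds p, 0 < s y := hs.continuous.continuousAt.eventually_const_lt h
        filter_upwards [h3, h4] with y h5 h6
        exact hmax ⟨Metric.ball_subset_closedBall h5, h6.le⟩
      have h7 := (pderiv_conditions_of_isLocalMax hV hloc 0).2
      have h8 := (pderiv_conditions_of_isLocalMax hV hloc 1).2
      linarith [hlap p]
  have hVx : V x = 0 := by simp [V, D, hx0, hrefl x hx0]; ring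
  have hder := hasDerivAt_line x i 0 (hV.differentiable (by simp) _)
  -- `V ≤ 0` on `B` and `V x = 0`, so `V` cannot increase along the inward normal at `x`; as `∂ᵢ V =
  -- ∂ᵢ f - L` there, this is the estimate.
  have hderiv : pderiv i V x ≤ 0 := by
    by_contra! hpos
    have hx' : x + (0 : ℝ) • (EuclideanSpace.single i 1 : Plane) = x := by simp
    rw [hx'] at hder
    have hmaxOn : IsLocalMaxOn (fun h : ℝ => V (x + h • EuclideanSpace.single i 1))
        (Set.Icc 0 1) 0 := by
      refine Filter.eventually_of_mem self_mem_nhdsWithin fun h hh => ?_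
      simp only [hx', hVx]
      refine hVB _ ⟨?_, ?_⟩
      · simpa [dist_eq_norm, norm_smul, abs_of_nonneg hh.1] using hh.2
      · simpa [s] using hh.1
    have hcone : (1 : ℝ) - 0 ∈ posTangentConeAt (Set.Icc (0 : ℝ) 1) 0 :=
      sub_mem_posTangentConeAt_of_segment_subset
        ((convex_Icc (0 : ℝ) 1).segment_subset ⟨le_rfl, zero_le_one⟩ ⟨zero_le_one, le_rfl⟩)
    have := hmaxOn.hasFDerivWithinAt_nonpos
      (hder.hasDerivWithinAt (s := Set.Icc 0 1)).hasFDerivWithinAt hcone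
    simp at this
    linarith
  have hfr' : pderiv i fr x = -pderiv i f x := by
    have hrx : reflect x i x = x := by simp [reflect]
    simp only [fr]
    rw [pderiv_comp_reflect hf]
    simp [hrx]
  rw [e1] at hderiv
  simp only [hfr', hx0] at hderiv
  simp at hderiv
  linarith

theorem abs_pderiv_le_of_laplacian_bounded {f : Plane → ℝ} (hf : ContDiff ℝ ∞ f) {K N : ℝ}
    (hK : ∀ x, |f x| ≤ K)
    (hN : ∀ x, |pderiv 0 (pderiv 0 f) x + pderiv 1 (pderiv 1 f) x| ≤ N) (i : Fin 2) (x : Plane) :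
    |pderiv i f x| ≤ 2 * K + N / 2 + 1 := by
  have hneg : ∀ {g : Plane → ℝ} k, pderiv k (fun y => -g y) = fun y => -pderiv k g y := by
    intro g k
    funext y
    rw [pderiv, show (fun y => -g y) = -g from rfl, fderiv_neg]
    simp [pderiv]
  have h := pderiv_le_of_laplacian_bounded hf.neg (K := K) (N := N)
    (fun y => by simpa using hK y) (fun y => by
      rw [hneg, hneg, hneg, hneg, ← neg_add, abs_neg]
      exact hN y) i x
  rw [hneg] at h
  rw [abs_le]
  exact ⟨by linarith, pderiv_le_of_laplacian_bounded hf hK hN i x⟩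

/-! ### Evolution equations and the Bernstein quantity -/

section
variable {F G a U : ℝ × Plane → ℝ} {p : ℝ × Plane}

theorem dd_dd_mul (hF : Smooth F) (hG : Smooth G) (v : ℝ × Plane) (hp : p ∈ halfSpace) :
    dd v (dd v (fun q => F q * G q)) p =
      F p * dd v (dd v G) p + 2 * dd v F p * dd v G p + dd v (dd v F) p * G p := by
  rw [dd_congr v (fun q hq => dd_mul hF hG v hq) hp,
    dd_add (hF.mul (hG.dd v)) ((hF.dd v).mul hG) v hp, dd_mul hF (hG.dd v) v hp,
    dd_mul (hF.dd v) hG v hp]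
  ring

theorem dd_dd_add (hF : Smooth F) (hG : Smooth G) (v w : ℝ × Plane) (hp : p ∈ halfSpace) :
    dd w (dd v (fun q => F q + G q)) p = dd w (dd v F) p + dd w (dd v G) p := by
  rw [dd_congr w (fun q hq => dd_add hF hG v hq) hp, dd_add (hF.dd v) (hG.dd v) w hp]

theorem dd_dd_const_mul (hF : Smooth F) (c : ℝ) (v w : ℝ × Plane) (hp : p ∈ halfSpace) :
    dd w (dd v (fun q => c * F q)) p = c * dd w (dd v F) p := by
  rw [dd_congr w (fun q hq => dd_const_mul hF c v hq) hp, dd_const_mul (hF.dd v) c w hp]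

theorem heat_mul (hF : Smooth F) (hG : Smooth G) (hp : p ∈ halfSpace) :
    heat a (fun q => F q * G q) p = F p * heat a G p + heat a F p * G p
      - 2 * a p * (dd (ex 0) F p * dd (ex 0) G p + dd (ex 1) F p * dd (ex 1) G p) := by
  simp only [heat]
  rw [dd_mul hF hG et hp, dd_dd_mul hF hG (ex 0) hp, dd_dd_mul hF hG (ex 1) hp]
  ring

theorem heat_add (hF : Smooth F) (hG : Smooth G) (hp : p ∈ halfSpace) :
    heat a (fun q => F q + G q) p = heat a F p + heat a G p := by
  simp only [heat]
  rw [dd_add hF hG et hp, dd_dd_add hF hG _ _ hp, dd_dd_add hF hG _ _ hp]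
  ring

theorem heat_const_mul (hF : Smooth F) (c : ℝ) (hp : p ∈ halfSpace) :
    heat a (fun q => c * F q) p = c * heat a F p := by
  simp only [heat]
  rw [dd_const_mul hF c et hp, dd_dd_const_mul hF _ _ _ hp, dd_dd_const_mul hF _ _ _ hp]
  ring

theorem heat_sub_const (c : ℝ) : heat a (fun q => F q - c) p = heat a F p := by
  have : ∀ v, dd v (fun q => F q - c) = dd v F := fun v => funext fun q => dd_sub_const c v
  simp only [heat, this]

theorem heat_comp (hF : Smooth F) {ψ ψ' ψ'' : ℝ → ℝ} (hψ : ∀ s, HasDerivAt ψ (ψ' s) s)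
    (hψ' : ∀ s, HasDerivAt ψ' (ψ'' s) s) (hs : ContDiff ℝ ∞ ψ') (hp : p ∈ halfSpace) :
    heat a (fun q => ψ (F q)) p = ψ' (F p) * heat a F p
      - a p * ψ'' (F p) * (dd (ex 0) F p ^ 2 + dd (ex 1) F p ^ 2) := by
  have h2 : ∀ v, dd v (dd v (fun q => ψ (F q))) p =
      ψ' (F p) * dd v (dd v F) p + ψ'' (F p) * dd v F p ^ 2 := by
    intro v
    rw [dd_congr v (fun q hq => dd_comp hF (hψ (F q)) v hq) hp,
      dd_mul (F := fun q => ψ' (F q)) (hs.comp_contDiffOn hF) (hF.dd v) v hp, dd_comp hF (hψ' (F p)) v hp]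
    ring
  simp only [heat]
  rw [h2, h2, dd_comp hF (hψ (F p)) et hp]
  ring

theorem heat_comp_fst {ψ : ℝ → ℝ} {ψ' : ℝ} (hψ : HasDerivAt ψ ψ' p.1)
    (hs : Differentiable ℝ ψ) (hp : p ∈ halfSpace) :
    heat a (fun q => ψ q.1) p = ψ' := by
  have h0 : ∀ i, dd (ex i) (dd (ex i) (fun q => ψ q.1)) p = 0 := by
    intro i
    rw [dd_congr (G := fun _ => 0) (ex i) (fun q hq => by
      rw [dd_comp_fst (hs q.1).hasDerivAt (ex i) hq]; simp [ex]) hp]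
    simp [dd]
  rw [heat, h0, h0, dd_comp_fst hψ et hp]
  simp [et]

/-- The conformal factor `e^{-2u}` of the inverse metric. -/
def invFactor (U : ℝ × Plane → ℝ) (p : ℝ × Plane) : ℝ := Real.exp (-2 * U p)

/-- `u` solves the equation `∂_t u = e^{-2u} Δu` satisfied by the conformal factor of a Ricci
flow on the plane. -/
structure IsLogDiffusion (U : ℝ × Plane → ℝ) : Prop where
  smooth : Smooth U
  eqn : ∀ p ∈ halfSpace, dd et U p =
    invFactor U p * (dd (ex 0) (dd (ex 0) U) p + dd (ex 1) (dd (ex 1) U) p)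

theorem invFactor_pos (U : ℝ × Plane → ℝ) (p : ℝ × Plane) : 0 < invFactor U p := Real.exp_pos _

namespace IsLogDiffusion

variable (hU : IsLogDiffusion U)
include hU

theorem heat_self (hp : p ∈ halfSpace) : heat (invFactor U) U p = 0 := by
  rw [heat, hU.eqn p hp]; ring

theorem dd_invFactor (v : ℝ × Plane) (hp : p ∈ halfSpace) :
    dd v (invFactor U) p = -2 * invFactor U p * dd v U p := by
  have h : HasDerivAt (fun s : ℝ => Real.exp (-2 * s)) (-2 * invFactor U p) (U p) :=
    (((hasDerivAt_id' (U p)).const_mul (-2)).exp).congr_deriv (by simp [invFactor]; ring)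
  exact dd_comp hU.smooth h v hp

theorem smooth_invFactor : Smooth (invFactor U) :=
  Real.contDiff_exp.comp_contDiffOn (contDiffOn_const.mul hU.smooth)

/-- Differentiate the equation in the direction `v`; the derivative falling on `e^{-2u}` gives the
right side. For `v = et` this is `L R = R²`. -/
theorem heat_dd (v : ℝ × Plane) (hp : p ∈ halfSpace) :
    heat (invFactor U) (dd v U) p = -2 * dd v U p * dd et U p := by
  have hs := hU.smooth
  have hc : ∀ e, dd v (dd e (dd e U)) p = dd e (dd e (dd v U)) p := by
    intro e
    rw [dd_comm (hs.dd e) v e hp, dd_congr e (fun q hq => dd_comm hs v e hq) hp]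
  have h := dd_congr v (fun q hq => hU.eqn q hq) hp
  have h2 := fun e => (hs.dd e).dd e
  rw [dd_mul hU.smooth_invFactor ((h2 (ex 0)).add (h2 (ex 1))) v hp,
    dd_add (h2 (ex 0)) (h2 (ex 1)) v hp, hU.dd_invFactor v hp, hc, hc, dd_comm hs v et hp] at h
  rw [heat, h, hU.eqn p hp]
  ring

end IsLogDiffusion

/-- The squared Euclidean length of the gradient. -/
def gradSq (U : ℝ × Plane → ℝ) (p : ℝ × Plane) : ℝ :=
  dd (ex 0) U p * dd (ex 0) U p + dd (ex 1) U p * dd (ex 1) U p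

/-- The weight in front of the gradient term of `bernsteinQuantity`. -/
def weight (A s : ℝ) : ℝ := (A + s ^ 2) * Real.exp (-2 * s)

/-- The Bernstein quantity `R + (A + u²) |∇u|²_g`. -/
def bernsteinQuantity (A : ℝ) (U : ℝ × Plane → ℝ) (p : ℝ × Plane) : ℝ :=
  -2 * dd et U p + weight A (U p) * gradSq U p

theorem contDiff_weight (A : ℝ) : ContDiff ℝ ∞ (weight A) := by
  unfold weight; fun_prop

theorem Smooth.gradSq (hU : Smooth U) : Smooth (gradSq U) :=
  ((hU.dd _).mul (hU.dd _)).add ((hU.dd _).mul (hU.dd _))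

theorem Smooth.bernsteinQuantity (hU : Smooth U) (A : ℝ) : Smooth (bernsteinQuantity A U) :=
  (contDiffOn_const.mul (hU.dd et)).add
    (((contDiff_weight A).comp_contDiffOn hU).mul hU.gradSq)

/-- The pointwise inequality behind `L Q ≤ -δ Q²`, with `e^{-4u}` factored out: `(x, y)` is `∇u`,
`r, s, q` are the second derivatives and `φ = A + u²`. In terms of the covariant Hessian `H` of `u`
and `P = |∇u|²`, the left side is `4 (tr H)² - 2φ|H|² - 2P² - 8u H(∇u, ∇u)`. The bound on `u` lets
`φ|H|² + P²` absorb the last term, and `φ ≥ 16` with `(tr H)² ≤ 2|H|²` leaves at most `-(P² + 4 (tr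
H)²)`. -/
theorem bernstein_algebra {u φ m x y r s q : ℝ} (hφ : 16 ≤ φ) (hu : 16 * u ^ 2 ≤ φ)
    (hm : φ ≤ m) :
    4 * (r + q) ^ 2 + φ * (-4 * (x ^ 2 + y ^ 2) * (r + q) - 2 * (r ^ 2 + 2 * s ^ 2 + q ^ 2))
      - (2 - 8 * u + 4 * φ) * (x ^ 2 + y ^ 2) ^ 2
      - 4 * (2 * u - 2 * φ) * (r * x ^ 2 + 2 * s * x * y + q * y ^ 2)
      ≤ -(1 / (2 * m ^ 2)) * (φ * (x ^ 2 + y ^ 2) - 2 * (r + q)) ^ 2 := by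
  obtain ⟨P, hP⟩ : ∃ P, P = x ^ 2 + y ^ 2 := ⟨_, rfl⟩
  -- Components of the Hessian for `e^{2u}(dx² + dy²)`: the Christoffel correction is trace-free.
  obtain ⟨H₁, h₁⟩ : ∃ H, H = r - 2 * x ^ 2 + P := ⟨_, rfl⟩
  obtain ⟨H₂, h₂⟩ : ∃ H, H = s - 2 * x * y := ⟨_, rfl⟩
  obtain ⟨H₃, h₃⟩ : ∃ H, H = q - 2 * y ^ 2 + P := ⟨_, rfl⟩
  obtain ⟨n, hn⟩ : ∃ n, n = H₁ ^ 2 + 2 * H₂ ^ 2 + H₃ ^ 2 := ⟨_, rfl⟩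
  obtain ⟨h, hh⟩ : ∃ h, h = H₁ * x ^ 2 + 2 * H₂ * x * y + H₃ * y ^ 2 := ⟨_, rfl⟩
  have hn0 : 0 ≤ n := by rw [hn]; positivity
  have hP0 : 0 ≤ P := by rw [hP]; positivity
  have hlap : r + q = H₁ + H₃ := by rw [h₁, h₃, hP]; ring
  have hcs : h ^ 2 ≤ n * P ^ 2 := by
    have : n * P ^ 2 - h ^ 2 = 2 * (H₁ * (x * y) - H₂ * x ^ 2) ^ 2 + (H₁ * y ^ 2 - H₃ * x ^ 2) ^ 2
        + 2 * (H₂ * y ^ 2 - H₃ * (x * y)) ^ 2 := by rw [hn, hh, hP]; ring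
    have : 0 ≤ n * P ^ 2 - h ^ 2 := by rw [this]; positivity
    linarith
  have habs : |8 * u * h| ≤ φ * n + P ^ 2 := by
    refine abs_le_of_sq_le_sq ?_ (by positivity)
    calc (8 * u * h) ^ 2 = 64 * u ^ 2 * h ^ 2 := by ring
      _ ≤ 64 * u ^ 2 * (n * P ^ 2) := by gcongr
      _ = 4 * (16 * u ^ 2) * (n * P ^ 2) := by ring
      _ ≤ 4 * φ * (n * P ^ 2) := by gcongr
      _ ≤ (φ * n + P ^ 2) ^ 2 := by linarith [sq_nonneg (φ * n - P ^ 2)]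
  have hl2 : (r + q) ^ 2 ≤ 2 * n := by
    rw [hlap, hn]; linarith [sq_nonneg (H₁ - H₃), sq_nonneg H₂]
  have e : 4 * (r + q) ^ 2 + φ * (-4 * (x ^ 2 + y ^ 2) * (r + q)
        - 2 * (r ^ 2 + 2 * s ^ 2 + q ^ 2))
      - (2 - 8 * u + 4 * φ) * (x ^ 2 + y ^ 2) ^ 2
      - 4 * (2 * u - 2 * φ) * (r * x ^ 2 + 2 * s * x * y + q * y ^ 2)
      = 4 * (r + q) ^ 2 - 2 * φ * n - 2 * P ^ 2 - 8 * u * h := by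
    rw [hn, hh, h₁, h₂, h₃, hP]; ring
  have hle : 4 * (r + q) ^ 2 - 2 * φ * n - 2 * P ^ 2 - 8 * u * h
      ≤ -(P ^ 2 + 4 * (r + q) ^ 2) := by
    have := (abs_le.1 habs).1
    have := mul_le_mul_of_nonneg_right hφ hn0
    linarith
  have hm0 : 0 < m := by linarith
  have hfin : (φ * P - 2 * (r + q)) ^ 2 ≤ 2 * m ^ 2 * (P ^ 2 + 4 * (r + q) ^ 2) := by
    have h3 : 1 ≤ m ^ 2 := by nlinarith
    calc (φ * P - 2 * (r + q)) ^ 2 ≤ 2 * φ ^ 2 * P ^ 2 + 2 * 1 * (4 * (r + q) ^ 2) := by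
          linarith [sq_nonneg (φ * P + 2 * (r + q))]
      _ ≤ 2 * m ^ 2 * P ^ 2 + 2 * m ^ 2 * (4 * (r + q) ^ 2) := by gcongr
      _ = _ := by ring
  rw [e, ← hP]
  refine hle.trans ?_
  rw [neg_mul, neg_le_neg_iff, div_mul_eq_mul_div, one_mul, div_le_iff₀ (by positivity)]
  linarith

theorem IsLogDiffusion.heat_bernstein_le (hU : IsLogDiffusion U) {A m : ℝ} (hA : 16 ≤ A)
    (hp : p ∈ halfSpace) (hu : 16 * U p ^ 2 ≤ A) (hm : A + U p ^ 2 ≤ m) :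
    heat (invFactor U) (bernsteinQuantity A U) p ≤ -(1 / (2 * m ^ 2)) * bernsteinQuantity A U p ^ 2 := by
  have hs := hU.smooth
  have hx := hs.dd (ex 0)
  have hy := hs.dd (ex 1)
  have hexp : ∀ s : ℝ, HasDerivAt (fun s : ℝ => Real.exp (-2 * s)) (-2 * Real.exp (-2 * s)) s :=
    fun s => (((hasDerivAt_id' s).const_mul (-2)).exp).congr_deriv (by ring)
  have hw : ∀ s, HasDerivAt (weight A) ((2 * s - 2 * (A + s ^ 2)) * Real.exp (-2 * s)) s :=
    fun s => (((hasDerivAt_pow 2 s).const_add A).mul (hexp s)).congr_deriv (by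
      simp; ring)
  have hw' : ∀ s, HasDerivAt (fun s => (2 * s - 2 * (A + s ^ 2)) * Real.exp (-2 * s))
      ((2 - 8 * s + 4 * (A + s ^ 2)) * Real.exp (-2 * s)) s :=
    fun s => ((((hasDerivAt_id' s).const_mul 2).sub
      (((hasDerivAt_pow 2 s).const_add A).const_mul 2)).mul (hexp s)).congr_deriv (by
      simp; ring)
  have hWs : Smooth (fun q => weight A (U q)) := (contDiff_weight A).comp_contDiffOn hs
  have hgrad : ∀ v, dd v (gradSq U) p = 2 * (dd (ex 0) U p * dd v (dd (ex 0) U) p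
      + dd (ex 1) U p * dd v (dd (ex 1) U) p) := by
    intro v
    have := dd_add (hx.mul hx) (hy.mul hy) v hp
    rw [dd_mul hx hx v hp, dd_mul hy hy v hp] at this
    exact this.trans (by ring)
  have hheatgrad := heat_add (a := invFactor U) (hx.mul hx) (hy.mul hy) hp
  rw [heat_mul hx hx hp, heat_mul hy hy hp, hU.heat_dd _ hp, hU.heat_dd _ hp] at hheatgrad
  change heat (invFactor U) (gradSq U) p = _ at hheatgrad
  have h1 := heat_add (a := invFactor U) (contDiffOn_const (c := (-2 : ℝ)).mul (hs.dd et))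
    (hWs.mul hs.gradSq) hp
  rw [heat_const_mul (hs.dd et) _ hp, hU.heat_dd _ hp, heat_mul hWs hs.gradSq hp,
    heat_comp hs hw hw' (by fun_prop) hp, hU.heat_self hp, hheatgrad, hgrad, hgrad,
    dd_comp hs (hw (U p)) _ hp, dd_comp hs (hw (U p)) _ hp,
    dd_comm hs (ex 1) (ex 0) hp] at h1
  change heat (invFactor U) (bernsteinQuantity A U) p = _ at h1
  rw [h1, bernsteinQuantity, gradSq, hU.eqn p hp, weight]
  have halg := bernstein_algebra (u := U p) (φ := A + U p ^ 2) (m := m) (x := dd (ex 0) U p)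
    (y := dd (ex 1) U p) (r := dd (ex 0) (dd (ex 0) U) p) (s := dd (ex 0) (dd (ex 1) U) p)
    (q := dd (ex 1) (dd (ex 1) U) p) (by nlinarith [sq_nonneg (U p)])
    (by nlinarith [sq_nonneg (U p)]) hm
  have := mul_le_mul_of_nonneg_left halg (sq_nonneg (invFactor U p))
  simp only [invFactor] at this ⊢
  linear_combination this

end

/-! ### Reduction of the Ricci flow to the scalar equation -/

/-- The conformal factor `u` of the metrics `g(t) = e^{2u} (dx² + dy²)`. -/
def conformalFactor (g : ℝ → TensorField) (p : ℝ × Plane) : ℝ :=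
  1 / 2 * Real.log (g p.1 p.2 0 0)

theorem conformalFactor_zero {g : ℝ → TensorField} {u₀ : Plane → ℝ}
    (h0 : g 0 = conformalMetric u₀) (x : Plane) :
    conformalFactor g (0, x) = u₀ x := by
  rw [conformalFactor, h0]
  simp [conformalMetric_apply]

namespace IsRicciFlow

variable {g : ℝ → TensorField} (hg : IsRicciFlow g)
include hg

theorem diag_pos {t : ℝ} (ht : 0 ≤ t) (x : Plane) : 0 < g t x 0 0 :=
  ((hg.metric t ht).posDef x).diag_pos

theorem smooth_conformalFactor : Smooth (conformalFactor g) :=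
  contDiffOn_const.mul ((hg.smooth 0 0).log fun p hp =>
    (hg.diag_pos (mem_halfSpace.1 hp) p.2).ne')

theorem exp_conformalFactor {t : ℝ} (ht : 0 ≤ t) (x : Plane) :
    Real.exp (2 * conformalFactor g (t, x)) = g t x 0 0 := by
  rw [conformalFactor, ← mul_assoc]
  norm_num
  exact Real.exp_log (hg.diag_pos ht x)

/-- Numerator and denominator solve the same linear ODE in time. -/
theorem ratio_eq {t : ℝ} (ht : 0 ≤ t) (x : Plane) (i j : Fin 2) :
    g t x i j / g t x 0 0 = g 0 x i j / g 0 x 0 0 := by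
  have hd : ∀ s, 0 ≤ s →
      HasDerivWithinAt (fun s => g s x i j / g s x 0 0) 0 (Set.Ici 0) s := by
    intro s hs
    refine ((hg.flow s hs x i j).div (hg.flow s hs x 0 0) (hg.diag_pos hs x).ne').congr_deriv ?_
    rw [div_eq_zero_iff]
    left; ring
  exact constant_of_has_deriv_right_zero (a := 0) (b := t)
    (fun s hs => ((hd s hs.1).mono fun y hy => hy.1).continuousWithinAt)
    (fun s hs => (hd s hs.1).mono fun y hy => hs.1.trans hy) t ⟨ht, le_rfl⟩

variable {u₀ : Plane → ℝ}

theorem eq_conformalMetric (h0 : g 0 = conformalMetric u₀) {t : ℝ} (ht : 0 ≤ t) :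
    g t = conformalMetric (fun x => conformalFactor g (t, x)) := by
  funext x
  ext i j
  rw [conformalMetric_apply, hg.exp_conformalFactor ht]
  have h := hg.ratio_eq ht x i j
  rw [div_eq_iff (hg.diag_pos ht x).ne', h0, conformalMetric_apply, conformalMetric_apply] at h
  rw [h]
  have := (Real.exp_pos (2 * u₀ x)).ne'
  simp only [if_true, mul_one]
  field_simp

theorem scalarCurvature_eq_laplacian (h0 : g 0 = conformalMetric u₀) {t : ℝ} (ht : 0 ≤ t)
    (x : Plane) :
    scalarCurvature (g t) x = -2 * (invFactor (conformalFactor g) (t, x) *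
      (dd (ex 0) (dd (ex 0) (conformalFactor g)) (t, x)
        + dd (ex 1) (dd (ex 1) (conformalFactor g)) (t, x))) := by
  have hs := hg.smooth_conformalFactor
  have h2 : ∀ i, pderiv i (pderiv i (fun y => conformalFactor g (t, y))) x =
      dd (ex i) (dd (ex i) (conformalFactor g)) (t, x) := by
    intro i
    rw [← pderiv_slice (hs.dd _) ht]
    congr 1
    funext y
    exact pderiv_slice hs ht i y
  rw [hg.eq_conformalMetric h0 ht, scalarCurvature_conformalMetric (contDiff_slice hs ht),
    h2, h2, invFactor]
  ring

theorem dd_time_conformalFactor {t : ℝ} (ht : 0 ≤ t) (x : Plane) :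
    dd et (conformalFactor g) (t, x) = -1 / 2 * scalarCurvature (g t) x := by
  have hpos := hg.diag_pos ht x
  have h := ((hg.flow t ht x 0 0).log hpos.ne').const_mul (1 / 2)
  have h2 := hasDerivWithinAt_time hg.smooth_conformalFactor ht x
  refine ((uniqueDiffOn_Ici 0 t ht).eq_deriv _ h2 h).trans ?_
  field_simp

theorem isLogDiffusion (h0 : g 0 = conformalMetric u₀) :
    IsLogDiffusion (conformalFactor g) where
  smooth := hg.smooth_conformalFactor
  eqn := by
    rintro ⟨t, x⟩ hp
    have ht : 0 ≤ t := mem_halfSpace.1 hp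
    rw [hg.dd_time_conformalFactor ht, hg.scalarCurvature_eq_laplacian h0 ht]
    ring

end IsRicciFlow

/-! ### A priori bounds for the scalar equation -/

namespace IsLogDiffusion

variable {U : ℝ × Plane → ℝ} (hU : IsLogDiffusion U) {T Λ : ℝ}
include hU

theorem le_add_of_time_deriv_le {C : ℝ} (hC : ∀ t ∈ Set.Icc 0 T, ∀ x, dd et U (t, x) ≤ C) :
    ∀ t ∈ Set.Icc 0 T, ∀ x, U (t, x) ≤ U (0, x) + C * t := by
  intro t ht x
  have h := image_le_of_deriv_right_le_deriv_boundary (f := fun s => U (s, x))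
    (f' := fun s => dd et U (s, x)) (a := 0) (b := t)
    (B := fun s => U (0, x) + C * s) (B' := fun _ => C)
    (fun s hs => ((hasDerivWithinAt_time hU.smooth hs.1 x).mono
      fun y hy => hy.1).continuousWithinAt)
    (fun s hs => (hasDerivWithinAt_time hU.smooth hs.1 x).mono fun y hy => hs.1.trans hy)
    (by simp) (by fun_prop)
    (fun s _ => ((((hasDerivAt_id' s).const_mul C).const_add _).congr_deriv
      (by ring)).hasDerivWithinAt)
    (fun s hs => hC s ⟨hs.1, hs.2.le.trans ht.2⟩ x)
  exact h ⟨ht.1, le_rfl⟩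

variable (hΛ : ∀ t ∈ Set.Icc 0 T, ∀ x, invFactor U (t, x) ≤ Λ)
include hΛ

theorem time_deriv_le {C : ℝ} (hC : 0 ≤ C) (h0 : ∀ x, 2 * dd et U (0, x) ≤ C) :
    ∀ t ∈ Set.Icc 0 T, ∀ x, 2 * dd et U (t, x) ≤ C / (1 + C * t) := by
  have hlin : Smooth (fun q => 1 + C * q.1) := by
    have : ContDiff ℝ ∞ (fun q : ℝ × Plane => 1 + C * q.1) := by fun_prop
    exact this.contDiffOn
  have h2 : Smooth (fun q => 2 * dd et U q) := contDiffOn_const.mul (hU.smooth.dd et)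
  intro t ht x
  have h1T : 0 < 1 + C * T := by
    have := mul_nonneg hC (ht.1.trans ht.2); linarith
  -- With `w = 2 ∂_t u`, `Z = (1 + C t) w - C` satisfies `L Z = -w Z`, and `(1 + C T) w ≥ Z` where
  -- `Z > 0`.
  have key := nonpos_of_heat_le_neg_sq (Z := fun q => (1 + C * q.1) * (2 * dd et U q) - C)
    (a := invFactor U) (T := T) (Λ := Λ) (δ := 1 / (1 + C * T))
    ((hlin.mul h2).sub contDiffOn_const) (by positivity)
    (fun t ht x => ⟨(invFactor_pos U _).le, hΛ t ht x⟩)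
    (fun x => by simpa using h0 x)
    (fun t ht x hpos => by
      have hp : (t, x) ∈ halfSpace := mem_halfSpace.2 ht.1
      have hψ : HasDerivAt (fun s : ℝ => 1 + C * s) C t :=
        (((hasDerivAt_id' t).const_mul C).const_add 1).congr_deriv (by ring)
      have hsp : ∀ i, dd (ex i) (fun q => 1 + C * q.1) (t, x) = 0 := by
        intro i
        rw [dd_comp_fst (ψ := fun s : ℝ => 1 + C * s) hψ _ hp]; simp [ex]
      rw [heat_sub_const, heat_mul hlin h2 hp, heat_const_mul (hU.smooth.dd et) _ hp,
        hU.heat_dd et hp, hsp, hsp,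
        heat_comp_fst (ψ := fun s : ℝ => 1 + C * s) hψ (by fun_prop) hp]
      simp only at hpos ⊢
      set w := 2 * dd et U (t, x)
      have hl : 0 < 1 + C * t := by
        have := mul_nonneg hC ht.1; linarith
      have hlT : 1 + C * t ≤ 1 + C * T := by
        have := mul_le_mul_of_nonneg_left ht.2 hC; linarith
      have e : (1 + C * t) * (2 * (-2 * dd et U (t, x) * dd et U (t, x))) + C * w
          - 2 * invFactor U (t, x) * (0 * dd (ex 0) (fun q => 2 * dd et U q) (t, x)
            + 0 * dd (ex 1) (fun q => 2 * dd et U q) (t, x))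
          = -(w * ((1 + C * t) * w - C)) := by
        simp only [w]; ring
      rw [e, neg_mul, neg_le_neg_iff, one_div, inv_mul_le_iff₀ h1T]
      set Z := (1 + C * t) * w - C with hZ
      have hw : 0 ≤ w := by
        by_contra! hneg
        have := mul_neg_of_pos_of_neg hl hneg
        linarith
      calc Z ^ 2 = Z * Z := sq Z
        _ ≤ (1 + C * t) * w * Z := by gcongr; linarith
        _ ≤ (1 + C * T) * w * Z := by gcongr
        _ = _ := by ring) t ht x
  have hl : 0 < 1 + C * t := by
    have := mul_nonneg hC ht.1; linarith
  rw [le_div_iff₀ hl]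
  simp only at key
  linarith

/-- A bounded solution stays within the bounds of its initial value. -/
theorem abs_le_of_bounded {D K : ℝ} (hD : ∀ t ∈ Set.Icc 0 T, ∀ x, |U (t, x)| ≤ D)
    (h0 : ∀ x, |U (0, x)| ≤ K) : ∀ t ∈ Set.Icc 0 T, ∀ x, |U (t, x)| ≤ K := by
  have hK : 0 ≤ K := (abs_nonneg _).trans (h0 0)
  have key : ∀ ε : ℝ, |ε| = 1 → ∀ t ∈ Set.Icc 0 T, ∀ x, ε * U (t, x) ≤ K := by
    intro ε hε t ht x
    have hD0 : 0 ≤ D := (abs_nonneg _).trans (hD t ht x)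
    have hεU : ∀ q, ε * U q ≤ |U q| := fun q =>
      (le_abs_self _).trans (by rw [abs_mul, hε, one_mul])
    have hexp : Smooth (fun q => Real.exp (-q.1)) := by
      have : ContDiff ℝ ∞ (fun q : ℝ × Plane => Real.exp (-q.1)) := by fun_prop
      exact this.contDiffOn
    have hεs : Smooth (fun q => ε * U q) := contDiffOn_const.mul hU.smooth
    have h2 : Smooth (fun q => ε * U q - K) := hεs.sub contDiffOn_const
    -- The factor `e^{-t}` creates the linear damping `L Z = -Z`; since `Z ≤ D + 1` where it is
    -- positive, this is also quadratic damping. The crude bound `D` affects only `δ`.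
    have := nonpos_of_heat_le_neg_sq (Z := fun q => Real.exp (-q.1) * (ε * U q - K))
      (a := invFactor U) (T := T) (Λ := Λ) (δ := 1 / (D + 1)) (hexp.mul h2) (by positivity)
      (fun t ht x => ⟨(invFactor_pos U _).le, hΛ t ht x⟩)
      (fun x => by
        have := (hεU (0, x)).trans (h0 x)
        simpa using this)
      (fun t ht x hpos => by
        have hp : (t, x) ∈ halfSpace := mem_halfSpace.2 ht.1
        have hψ : ∀ s : ℝ, HasDerivAt (fun s : ℝ => Real.exp (-s)) (-Real.exp (-s)) s :=
          fun s => ((hasDerivAt_neg s).exp).congr_deriv (by ring)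
        have hsp : ∀ i, dd (ex i) (fun q => Real.exp (-q.1)) (t, x) = 0 := by
          intro i
          rw [dd_comp_fst (ψ := fun s : ℝ => Real.exp (-s)) (hψ t) _ hp]; simp [ex]
        rw [heat_mul hexp h2 hp, heat_sub_const, heat_const_mul hU.smooth _ hp,
          hU.heat_self hp, hsp, hsp,
          heat_comp_fst (ψ := fun s : ℝ => Real.exp (-s)) (hψ t) (by fun_prop) hp]
        simp only at hpos ⊢
        have hU1 : ε * U (t, x) - K ≤ D + 1 := by
          linarith [hεU (t, x), hD t ht x]
        have hpos' : 0 < ε * U (t, x) - K := pos_of_mul_pos_right hpos (Real.exp_pos _).le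
        have hexp1 : Real.exp (-t) ≤ 1 := Real.exp_le_one_iff.2 (by linarith [ht.1])
        set E := Real.exp (-t)
        set z := ε * U (t, x) - K
        have hzD : E * z ≤ D + 1 := by nlinarith
        have hq : (1 / (D + 1)) * (E * z) ^ 2 ≤ E * z := by
          rw [one_div, inv_mul_le_iff₀ (by positivity), sq]
          gcongr
        linarith) t ht x
    simp only at this
    have h3 := nonpos_of_mul_nonpos_right this (Real.exp_pos (-t))
    linarith
  intro t ht x
  rw [abs_le]
  have h1 := key 1 (by simp) t ht x
  have h2 := key (-1) (by simp) t ht x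
  constructor <;> linarith

theorem bernstein_le {A K M : ℝ} (hA : 16 ≤ A) (hAK : 16 * K ^ 2 ≤ A) (hM : 0 ≤ M)
    (hK : ∀ t ∈ Set.Icc 0 T, ∀ x, |U (t, x)| ≤ K) (h0 : ∀ x, bernsteinQuantity A U (0, x) ≤ M) :
    ∀ t ∈ Set.Icc 0 T, ∀ x, bernsteinQuantity A U (t, x) ≤ M := by
  intro t ht x
  have hm : 0 < A + K ^ 2 := by positivity
  have := nonpos_of_heat_le_neg_sq (Z := fun q => bernsteinQuantity A U q - M)
    (a := invFactor U) (T := T) (Λ := Λ) (δ := 1 / (2 * (A + K ^ 2) ^ 2))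
    ((hU.smooth.bernsteinQuantity A).sub contDiffOn_const) (by positivity)
    (fun t ht x => ⟨(invFactor_pos U _).le, hΛ t ht x⟩)
    (fun x => by linarith [h0 x])
    (fun t ht x hpos => by
      have hp : (t, x) ∈ halfSpace := mem_halfSpace.2 ht.1
      have hsq : U (t, x) ^ 2 ≤ K ^ 2 := sq_le_sq' (abs_le.1 (hK t ht x)).1 (abs_le.1 (hK t ht x)).2
      rw [heat_sub_const]
      refine (hU.heat_bernstein_le hA hp (by linarith) (m := A + K ^ 2) (by linarith)).trans ?_
      rw [neg_mul, neg_mul, neg_le_neg_iff]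
      gcongr
      linarith) t ht x
  linarith

end IsLogDiffusion

theorem LocallyUniformlyComplete.exists_invFactor_le {g : ℝ → TensorField} {u₀ : Plane → ℝ}
    (hg : IsRicciFlow g) (h0 : g 0 = conformalMetric u₀) (hc : LocallyUniformlyComplete g)
    {K : ℝ} (hK : ∀ x, |u₀ x| ≤ K) (T : ℝ) :
    ∃ Λ, ∀ t ∈ Set.Icc 0 T, ∀ x, invFactor (conformalFactor g) (t, x) ≤ Λ := by
  obtain ⟨c, hc0, hc⟩ := hc T
  refine ⟨Real.exp (2 * K) / c, fun t ht x => ?_⟩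
  -- Testing completeness on the first coordinate vector is enough, as the metric is conformal.
  have h := hc t ht x (Pi.single 0 1)
  have e : ∀ M : Matrix (Fin 2) (Fin 2) ℝ,
      (Pi.single 0 1 : Fin 2 → ℝ) ⬝ᵥ M.mulVec (Pi.single 0 1) = M 0 0 := by
    intro M; simp
  rw [e, e, h0, ← hg.exp_conformalFactor ht.1 x, conformalMetric_apply, if_pos rfl, mul_one] at h
  have h1 : Real.exp (-(2 * K)) ≤ Real.exp (2 * u₀ x) :=
    Real.exp_le_exp.2 (by linarith [(abs_le.1 (hK x)).1])
  have h2 : c * Real.exp (-(2 * K)) ≤ Real.exp (2 * conformalFactor g (t, x)) :=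
    le_trans (by gcongr) h
  rw [invFactor, neg_mul, Real.exp_neg, le_div_iff₀ hc0, inv_mul_le_iff₀ (Real.exp_pos _)]
  rw [Real.exp_neg, ← div_eq_mul_inv, div_le_iff₀ (Real.exp_pos _)] at h2
  exact h2

/-! ### Choice of constants and conclusion -/

/-- Curvature bounds for the complete Ricci flow starting at a bounded conformal metric of
bounded curvature. -/
theorem exists_scalarCurvature_bounds (u₀ : Plane → ℝ) (hu₀ : ContDiff ℝ ∞ u₀)
    (hu₀_bdd : ∃ K : ℝ, ∀ x, |u₀ x| ≤ K)
    (hR₀_bdd : ∃ k : ℝ, ∀ x,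
      |scalarCurvature (conformalMetric u₀) x| ≤ k) :
    ∃ C : ℝ, 0 < C ∧
      ∀ g : ℝ → TensorField,
        IsRicciFlow g →
        g 0 = conformalMetric u₀ →
        LocallyUniformlyComplete g →
        ∀ (x : Plane) (t : ℝ), 0 ≤ t →
          -C / (1 + C * t) ≤ scalarCurvature (g t) x ∧
            scalarCurvature (g t) x ≤ C := by
  obtain ⟨K, hK⟩ := hu₀_bdd
  obtain ⟨k, hk⟩ := hR₀_bdd
  have hK0 : 0 ≤ K := (abs_nonneg _).trans (hK 0)
  have hk0 : 0 ≤ k := (abs_nonneg _).trans (hk 0)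
  obtain ⟨A, hA⟩ : ∃ A, A = 16 + 16 * K ^ 2 := ⟨_, rfl⟩
  obtain ⟨N, hN⟩ : ∃ N, N = k * Real.exp (2 * K) := ⟨_, rfl⟩
  obtain ⟨L, hL⟩ : ∃ L, L = 2 * K + N / 2 + 1 := ⟨_, rfl⟩
  obtain ⟨M, hM⟩ : ∃ M, M = k + (A + K ^ 2) * Real.exp (2 * K) * (L ^ 2 + L ^ 2) := ⟨_, rfl⟩
  have hA0 : 0 < A := by rw [hA]; positivity
  have hkM : k ≤ M := by
    rw [hM]
    have : 0 ≤ (A + K ^ 2) * Real.exp (2 * K) * (L ^ 2 + L ^ 2) := by positivity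
    linarith
  have hlap : ∀ x, |pderiv 0 (pderiv 0 u₀) x + pderiv 1 (pderiv 1 u₀) x| ≤ N := by
    intro x
    have h := hk x
    rw [scalarCurvature_conformalMetric hu₀, abs_mul, abs_mul, Real.abs_exp] at h
    have h1 : Real.exp (-(2 * K)) ≤ Real.exp (-2 * u₀ x) :=
      Real.exp_le_exp.2 (by linarith [(abs_le.1 (hK x)).2])
    set l := |pderiv 0 (pderiv 0 u₀) x + pderiv 1 (pderiv 1 u₀) x|
    have hl : 0 ≤ l := abs_nonneg _
    have h2 : Real.exp (-(2 * K)) * l ≤ k := by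
      have := mul_le_mul_of_nonneg_right h1 hl
      have h3 : 0 ≤ Real.exp (-2 * u₀ x) * l := by positivity
      rw [abs_of_neg (by norm_num)] at h
      linarith
    rw [Real.exp_neg, inv_mul_le_iff₀ (Real.exp_pos _)] at h2
    rw [hN]; linarith
  have hgrad : ∀ i x, |pderiv i u₀ x| ≤ L := fun i x =>
    hL ▸ abs_pderiv_le_of_laplacian_bounded hu₀ hK hlap i x
  refine ⟨M + 1, by linarith, fun g hg h0 hc x t ht => ?_⟩
  set U := conformalFactor g
  have hU : IsLogDiffusion U := hg.isLogDiffusion h0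
  have hU0 : ∀ y, U (0, y) = u₀ y := conformalFactor_zero h0
  have hR : ∀ {s : ℝ}, 0 ≤ s → ∀ y, scalarCurvature (g s) y = -2 * dd et U (s, y) := by
    intro s hs y
    rw [hg.dd_time_conformalFactor hs]; ring
  obtain ⟨Λ, hΛ⟩ := hc.exists_invFactor_le hg h0 hK t
  have hR0 : ∀ y, |-2 * dd et U (0, y)| ≤ k := by
    intro y
    rw [← hR le_rfl, h0]; exact hk y
  have hlow := hU.time_deriv_le hΛ (C := M + 1) (by linarith) (fun y => by
    linarith [(abs_le.1 (hR0 y)).1])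
  have hmem : t ∈ Set.Icc 0 t := ⟨ht, le_rfl⟩
  have hup := hU.le_add_of_time_deriv_le (T := t) (C := M + 1) (fun s hs y => by
    have h1 := hlow s hs y
    have h2 : (M + 1) / (1 + (M + 1) * s) ≤ M + 1 :=
      div_le_self (by linarith) (by
        have := mul_nonneg (show 0 ≤ M + 1 by linarith) hs.1
        linarith)
    linarith)
  -- A bound depending on `Λ` and `t`, needed only to be finite: below from `-2u ≤ e^{-2u} ≤ Λ`,
  -- above by integrating the bound on `∂_t u`. The next use of the maximum principle improves it to
  -- `K`.
  have hbound : ∀ s ∈ Set.Icc 0 t, ∀ y, |U (s, y)| ≤ max Λ (K + (M + 1) * t) := by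
    intro s hs y
    have h1 : -2 * U (s, y) ≤ Λ := by
      have := Real.add_one_le_exp (-2 * U (s, y))
      have := hΛ s hs y
      rw [invFactor] at this
      linarith
    have hΛ0 : 0 ≤ Λ := (invFactor_pos U _).le.trans (hΛ s hs y)
    have h2 := hup s hs y
    have h3 : (M + 1) * s ≤ (M + 1) * t := mul_le_mul_of_nonneg_left hs.2 (by linarith)
    rw [hU0] at h2
    have h4 := (abs_le.1 (hK y)).2
    have := le_max_left Λ (K + (M + 1) * t)
    have := le_max_right Λ (K + (M + 1) * t)
    rw [abs_le]
    constructor <;> linarith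
  have habs := hU.abs_le_of_bounded hΛ hbound (K := K) (fun y => by rw [hU0]; exact hK y)
  have hpd : ∀ i y, dd (ex i) U (0, y) = pderiv i u₀ y := by
    intro i y
    rw [← pderiv_slice hU.smooth le_rfl]
    congr 1
    funext z
    exact hU0 z
  have hQ := hU.bernstein_le hΛ (A := A) (K := K) (M := M) (by rw [hA]; nlinarith [sq_nonneg K])
    (by rw [hA]; linarith) (by linarith) habs (fun y => by
      have h1 := (abs_le.1 (hR0 y)).2
      rw [bernsteinQuantity, weight, gradSq, hpd, hpd, hU0, hM]
      have hsq : ∀ i, pderiv i u₀ y * pderiv i u₀ y ≤ L ^ 2 := by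
        intro i
        rw [← sq]
        exact sq_le_sq' (abs_le.1 (hgrad i y)).1 (abs_le.1 (hgrad i y)).2
      have hu2 : u₀ y ^ 2 ≤ K ^ 2 := sq_le_sq' (abs_le.1 (hK y)).1 (abs_le.1 (hK y)).2
      have hexp : Real.exp (-2 * u₀ y) ≤ Real.exp (2 * K) :=
        Real.exp_le_exp.2 (by linarith [(abs_le.1 (hK y)).1])
      have := hsq 0
      have := hsq 1
      have : 0 ≤ pderiv 0 u₀ y * pderiv 0 u₀ y + pderiv 1 u₀ y * pderiv 1 u₀ y :=
        add_nonneg (mul_self_nonneg _) (mul_self_nonneg _)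
      gcongr)
  rw [hR ht]
  constructor
  · have := hlow t hmem x
    rw [neg_div]; linarith
  · have h1 := hQ t hmem x
    rw [bernsteinQuantity] at h1
    have h2 : 0 ≤ weight A (U (t, x)) * gradSq U (t, x) :=
      mul_nonneg (mul_nonneg (by positivity) (Real.exp_pos _).le)
        (add_nonneg (mul_self_nonneg _) (mul_self_nonneg _))
    linarith

end PlaneRicciFlow

end

theorem mainTheorem3 (u₀ : PlaneRicciFlow.Plane → ℝ) (hu₀ : ContDiff ℝ ∞ u₀)
    (hu₀_bdd : ∃ K : ℝ, ∀ x, |u₀ x| ≤ K)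
    (hR₀_bdd : ∃ k : ℝ, ∀ x,
      |PlaneRicciFlow.scalarCurvature (PlaneRicciFlow.conformalMetric u₀) x| ≤ k) :
    ∃ C : ℝ, 0 < C ∧
      ∀ g : ℝ → PlaneRicciFlow.TensorField,
        PlaneRicciFlow.IsRicciFlow g →
        g 0 = PlaneRicciFlow.conformalMetric u₀ →
        PlaneRicciFlow.LocallyUniformlyComplete g →
        ∀ (x : PlaneRicciFlow.Plane) (t : ℝ), 0 ≤ t →
          -C / (1 + C * t) ≤ PlaneRicciFlow.scalarCurvature (g t) x ∧
            PlaneRicciFlow.scalarCurvature (g t) x ≤ C :=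
  PlaneRicciFlow.exists_scalarCurvature_bounds u₀ hu₀ hu₀_bdd hR₀_bdd
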